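/- **Theorem (Compactness).** Let $d\ge 1$. A *tile* is a nonempty compact subset of $\mathbb R^d$ that is the closure of its interior. Let $\mathbf T$ be a finite set of tiles (each representing a prototile, i.e. a tile up to translation). A *tiling* is a set of tiles with pairwise disjoint interiors whose union is $\mathbb R^d$, and the full shift $X_{\mathbf T}$ is the set of all tilings whose tiles are translates of elements of $\mathbf T$. A *patch* of a tiling $\mathcal T$ is a finite subset of $\mathcal T$; its support is the union of its tiles. For a compact set $K$, let $\mathcal T[[K]]$ be the set of patches of $\mathcal T$ whose support contains $K$, and $\mathcal T[K]=\bigcap_{P\in\mathcal T[[K]]}P$. Let $B_r$ and $S_r$ be the closed ball and the sphere of centre $0$ and radius $r$, let $H$ be the Hausdorff distance of compact sets, put $$H(P_0,P_1)=\max\Bigl(\max_{t_0\in P_0}\min_{t_1\in P_1}H(t_0,t_1),\ \max_{t_1\in P_1}\min_{t_0\in P_0}H(t_0,t_1)\Bigr)$$ for patches, and $\partial_R\mathcal T=S_R\cup\bigcup_{t\in\mathcal T}(\partial t\cap B_R)$. For $\mathcal T_0,\mathcal T_1\in X_{\mathbf T}$ define the strong distances $$d_{s1}(\mathcal T_0,\mathcal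 T_1)=\inf\bigl(\{1\}\cup\{r>0:\exists x\in B_r,\ P_0\in\mathcal T_0[[B_{1/r}]],\ P_1\in\mathcal T_1[[B_{1/r}]],\ P_0=P_1+x\}\bigr),$$ $$d_{s2}(\mathcal T_0,\mathcal T_1)=\inf\bigl(\{1\}\cup\{r>0:\exists x_0,x_1\in B_r,\ (\mathcal T_0+x_0)[B_{1/r}]=(\mathcal T_1+x_1)[B_{1/r}]\}\bigr),$$ and the weak distances $$d_{w1}(\mathcal T_0,\mathcal T_1)=\inf\bigl(\{1\}\cup\{r>0:\exists P_0\in\mathcal T_0[[B_{1/r}]],\ P_1\in\mathcal T_1[[B_{1/r}]],\ H(P_0,P_1)\le r\}\bigr),$$ $$d_{w2}(\mathcal T_0,\mathcal T_1)=\inf\bigl(\{1\}\cup\{r>0:H(\partial_{1/r}\mathcal T_0,\partial_{1/r}\mathcal T_1)\le r\}\bigr).$$ Each of these distances induces a topology on $X_{\mathbf T}$: a set is open if it contains a ball of positive radius around each of its points. A *subshift for* one of them is a translation-invariant subset $X\subseteq X_{\mathbf T}$ that is closed in the topology it induces. A set $X\subseteq X_{\mathbf T}$ has *finite local complexity* (FLC)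 if for every compact $K\subset\mathbb R^d$ there are, up to translation, only finitely many patches of tilings of $X$ whose support is contained in $K$. Then: 1. If $X\subseteq X_{\mathbf T}$ has FLC and is a subshift for at least one of the four distances, then $X$ is compact for the strong distances $d_{s1}$ and $d_{s2}$ (and also for the weak distances $d_{w1}$ and $d_{w2}$). 2. If $X\subseteq X_{\mathbf T}$ is a subshift for $d_{w1}$ or for $d_{w2}$, then $X$ is compact for both $d_{w1}$ and $d_{w2}$. In particular the full shift $X_{\mathbf T}$ itself is compact for $d_{w1}$ and $d_{w2}$. -/

import Mathlib

open scoped Pointwise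

noncomputable section

namespace TilingSpace

/-- The Euclidean space `ℝ^d`. -/
abbrev E (d : ℕ) : Type := EuclideanSpace ℝ (Fin d)

variable {d : ℕ}

/-- A tile: a nonempty compact set which is the closure of its interior. -/
structure IsTile (t : Set (E d)) : Prop where
  nonempty : t.Nonempty
  isCompact : IsCompact t
  closure_interior : closure (interior t) = t

/-- A tiling: a set of tiles, with pairwise disjoint interiors, that covers the space. -/
structure IsTiling (T : Set (Set (E d))) : Prop where
  isTile : ∀ t ∈ T, IsTile t
  nonoverlap : ∀ s ∈ T, ∀ t ∈ T, s ≠ t → Disjoint (interior s) (interior t)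
  covers : ⋃₀ T = Set.univ

/-- The full shift of `Tset`: all tilings by translates of elements of `Tset`. The set `Tset` lists
representatives of the prototiles (a prototile is a tile up to translation). -/
def fullShift (Tset : Set (Set (E d))) : Set (Set (Set (E d))) :=
  {T | IsTiling T ∧ ∀ t ∈ T, ∃ p ∈ Tset, ∃ x : E d, t = x +ᵥ p}

/-- `P` is a patch of `T`: a finite set of tiles of `T`. -/
def IsPatch (P T : Set (Set (E d))) : Prop :=
  P.Finite ∧ P ⊆ T

/-- `T[[K]]`: the patches of `T` whose support (the union of their tiles) contains `K`. -/
def coveringPatches (T : Set (Set (E d))) (K : Set (E d)) : Set (Set (Set (E d))) :=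
  {P | IsPatch P T ∧ K ⊆ ⋃₀ P}

/-- `T[K]`: the intersection of all the patches in `T[[K]]`. -/
def smallestPatch (T : Set (Set (E d))) (K : Set (E d)) : Set (Set (E d)) :=
  ⋂₀ coveringPatches T K

/-- The closed ball of centre `0` and radius `r`. -/
abbrev ball₀ (d : ℕ) (r : ℝ) : Set (E d) := Metric.closedBall 0 r

/-- Hausdorff distance between two patches,
`max (max_{t₀ ∈ P₀} min_{t₁ ∈ P₁} H(t₀, t₁)) (max_{t₁ ∈ P₁} min_{t₀ ∈ P₀} H(t₀, t₁))`,
with `H(t₀, t₁)` the Hausdorff distance of compact sets. The sets involved are finite, so the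
suprema and infima are maxima and minima. -/
def patchDist (P₀ P₁ : Set (Set (E d))) : ℝ :=
  max
    (sSup ((fun t₀ => sInf ((fun t₁ => Metric.hausdorffDist t₀ t₁) '' P₁)) '' P₀))
    (sSup ((fun t₁ => sInf ((fun t₀ => Metric.hausdorffDist t₀ t₁) '' P₀)) '' P₁))

/-- `∂_R T`: the sphere of radius `R` together with the part of the boundaries of the tiles of `T`
that lies in the closed ball of radius `R`. -/
def rBoundary (R : ℝ) (T : Set (Set (E d))) : Set (E d) :=
  Metric.sphere 0 R ∪ ⋃ t ∈ T, frontier t ∩ ball₀ d R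

/-- The first strong tiling distance. -/
def ds1 (T₀ T₁ : Set (Set (E d))) : ℝ :=
  sInf ({1} ∪ {r : ℝ | 0 < r ∧ ∃ x ∈ ball₀ d r,
    ∃ P₀ ∈ coveringPatches T₀ (ball₀ d (1 / r)), ∃ P₁ ∈ coveringPatches T₁ (ball₀ d (1 / r)),
      P₀ = x +ᵥ P₁})

/-- The second strong tiling distance. -/
def ds2 (T₀ T₁ : Set (Set (E d))) : ℝ :=
  sInf ({1} ∪ {r : ℝ | 0 < r ∧ ∃ x₀ ∈ ball₀ d r, ∃ x₁ ∈ ball₀ d r,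
    smallestPatch (x₀ +ᵥ T₀) (ball₀ d (1 / r)) = smallestPatch (x₁ +ᵥ T₁) (ball₀ d (1 / r))})

/-- The first weak tiling distance, through the Hausdorff distance of patches. -/
def dw1 (T₀ T₁ : Set (Set (E d))) : ℝ :=
  sInf ({1} ∪ {r : ℝ | 0 < r ∧
    ∃ P₀ ∈ coveringPatches T₀ (ball₀ d (1 / r)), ∃ P₁ ∈ coveringPatches T₁ (ball₀ d (1 / r)),
      patchDist P₀ P₁ ≤ r})

/-- The second weak tiling distance, through the Hausdorff distance of boundaries. -/
def dw2 (T₀ T₁ : Set (Set (E d))) : ℝ :=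
  sInf ({1} ∪ {r : ℝ | 0 < r ∧
    Metric.hausdorffDist (rBoundary (1 / r) T₀) (rBoundary (1 / r) T₁) ≤ r})

/-- The topology on the full shift that a distance `δ` on tilings induces: a set is open when it
contains, around each of its points, a ball of positive radius for `δ`. -/
@[reducible]
def distTopology (Tset : Set (Set (E d))) (δ : Set (Set (E d)) → Set (Set (E d)) → ℝ) :
    TopologicalSpace (fullShift Tset) where
  IsOpen U := ∀ T ∈ U, ∃ ε > 0, ∀ T' : fullShift Tset, δ T T' < ε → T' ∈ U
  isOpen_univ := fun _ _ => ⟨1, one_pos, fun _ _ => Set.mem_univ _⟩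
  isOpen_inter := by
    intro U V hU hV T hT
    obtain ⟨ε, hε, h⟩ := hU T hT.1
    obtain ⟨η, hη, k⟩ := hV T hT.2
    exact ⟨min ε η, lt_min hε hη, fun T' hT' =>
      ⟨h T' (lt_of_lt_of_le hT' (min_le_left _ _)), k T' (lt_of_lt_of_le hT' (min_le_right _ _))⟩⟩
  isOpen_sUnion := by
    intro S hS T hT
    obtain ⟨U, hU, hTU⟩ := hT
    obtain ⟨ε, hε, h⟩ := hS U hU T hTU
    exact ⟨ε, hε, fun T' hT' => ⟨U, hU, h T' hT'⟩⟩

/-- `X` is closed in the full shift for the distance `δ`. -/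
def IsClosedFor {Tset : Set (Set (E d))} (δ : Set (Set (E d)) → Set (Set (E d)) → ℝ)
    (X : Set (fullShift Tset)) : Prop :=
  @IsClosed (fullShift Tset) (distTopology Tset δ) X

/-- `X` is compact for the distance `δ`. -/
def IsCompactFor {Tset : Set (Set (E d))} (δ : Set (Set (E d)) → Set (Set (E d)) → ℝ)
    (X : Set (fullShift Tset)) : Prop :=
  @IsCompact (fullShift Tset) (distTopology Tset δ) X

theorem IsTile.vadd {t : Set (E d)} (h : IsTile t) (x : E d) : IsTile (x +ᵥ t) where
  nonempty := h.nonempty.vadd_set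
  isCompact := h.isCompact.vadd x
  closure_interior := by rw [interior_vadd, closure_vadd, h.closure_interior]

theorem vadd_mem_fullShift {Tset : Set (Set (E d))} {T : Set (Set (E d))} (h : T ∈ fullShift Tset)
    (x : E d) : x +ᵥ T ∈ fullShift Tset := by
  obtain ⟨hT, hp⟩ := h
  refine ⟨⟨?_, ?_, ?_⟩, ?_⟩
  · rintro _ ⟨t, ht, rfl⟩
    exact (hT.isTile t ht).vadd x
  · rintro _ ⟨s, hs, rfl⟩ _ ⟨t, ht, rfl⟩ hst
    have hd := hT.nonoverlap s hs t ht (fun e => hst (by rw [e]))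
    simp only [interior_vadd]
    exact Set.disjoint_vadd_set.2 hd
  · refine Set.eq_univ_of_forall fun y => ?_
    have hy : -x +ᵥ y ∈ ⋃₀ T := by rw [hT.covers]; trivial
    obtain ⟨t, ht, hyt⟩ := hy
    exact ⟨x +ᵥ t, ⟨t, ht, rfl⟩, Set.mem_vadd_set_iff_neg_vadd_mem.2 hyt⟩
  · rintro _ ⟨t, ht, rfl⟩
    obtain ⟨p, hp, y, rfl⟩ := hp t ht
    exact ⟨p, hp, x + y, (add_vadd x y p).symm⟩

/-- The shift action of `ℝ^d` on the full shift. -/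
def shift {Tset : Set (Set (E d))} (x : E d) (T : fullShift Tset) : fullShift Tset :=
  ⟨x +ᵥ (T : Set (Set (E d))), vadd_mem_fullShift T.2 x⟩

/-- `X` is a subshift, relative to the distance `δ`: it is closed in the full shift for `δ` and
invariant under all translations. -/
structure IsSubshift {Tset : Set (Set (E d))} (δ : Set (Set (E d)) → Set (Set (E d)) → ℝ)
    (X : Set (fullShift Tset)) : Prop where
  closed : IsClosedFor δ X
  invariant : ∀ x : E d, shift x '' X = X

/-- `X]]K[[`: the patches of the tilings of `X` whose support is contained in `K`. -/
def subpatches {Tset : Set (Set (E d))} (X : Set (fullShift Tset)) (K : Set (E d)) :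
    Set (Set (Set (E d))) :=
  {P | ∃ T ∈ X, IsPatch P (T : Set (Set (E d))) ∧ ⋃₀ P ⊆ K}

/-- Finite local complexity: for every compact `K`, there are finitely many patches in `X]]K[[` up
to translation. -/
def IsFLC {Tset : Set (Set (E d))} (X : Set (fullShift Tset)) : Prop :=
  ∀ K : Set (E d), IsCompact K →
    ∃ F : Set (Set (Set (E d))), F.Finite ∧ ∀ P ∈ subpatches X K, ∃ Q ∈ F, ∃ x : E d, P = x +ᵥ Q

end TilingSpace

end

open TilingSpace

/-!
Compactness is proved with ultrafilters, which avoids any metric property of the four distances: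
only the definition of their topologies is used, namely that a neighbourhood of a tiling contains a
ball around it.

An ultrafilter `F` on the full shift has a canonical limit, `limitTiling F`: it consists of the
translates `t` of prototiles such that `F`-almost every tiling has a tile arbitrarily close to `t`.
As there are finitely many prototiles, and the positions of tiles meeting a compact set are
bounded, a choice of such a tile in every tiling converges along `F` to a limit tile
(`exists_mem_limitTiling`). Hence the limit tiles cover the space; they do not overlap because two
overlapping ones would be limits of overlapping, hence equal, tiles. So the limit is a tiling of the
full shift (`limitTiling_mem_fullShift`).

The same extraction, together with local finiteness (`finite_tiles_meeting`), shows that on a given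
compact set the tiles of almost every tiling correspond to those of the limit up to small
translations (`eventually_near_limitTiling`). This gives the convergence of `F` to its limit for
`dw1` and for `dw2`. If `F` contains a set with finite local complexity, then the patches covering
a ball are, for almost every tiling, translates of one patch by vectors that converge along `F`, so
that almost every tiling agrees with the limit on a large ball up to a small translation
(`eventually_exists_common_patch`); this gives the convergence for `ds1` and for `ds2`.

The limit does not depend on the distance. If `X` is closed for one distance for which the
ultrafilters containing `X` converge, their limits lie in `X`, and `X` is then compact for each
distance for which they converge (`isCompactFor_of_convergesFor`).
-/

namespace TilingSpace

open Filter Topology Metric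

/-! ### Translates of sets -/

theorem frontier_vadd_set {d : ℕ} (v : E d) (t : Set (E d)) :
    frontier (v +ᵥ t) = v +ᵥ frontier t := by
  rw [frontier, frontier, closure_vadd, interior_vadd, Set.vadd_set_sdiff]

theorem _root_.IsCompact.sub_set {d : ℕ} {K L : Set (E d)} (hK : IsCompact K) (hL : IsCompact L) :
    IsCompact (K - L) := by
  rw [sub_eq_add_neg]
  exact hK.add hL.neg

theorem hausdorffDist_vadd_le {d : ℕ} (v : E d) (t : Set (E d)) :
    hausdorffDist t (v +ᵥ t) ≤ ‖v‖ := by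
  refine hausdorffDist_le_of_mem_dist (norm_nonneg v)
    (fun x hx => ⟨v + x, Set.vadd_mem_vadd_set hx, by simp⟩) ?_
  rintro _ ⟨x, hx, rfl⟩
  exact ⟨x, hx, by simp⟩

/-! ### Tiles and tilings of the full shift -/

section FullShift

variable {d : ℕ} {Tset : Set (Set (E d))}

theorem IsTile.inter_interior_nonempty {t : Set (E d)} (ht : IsTile t) {U : Set (E d)}
    (hU : IsOpen U) {z : E d} (hzt : z ∈ t) (hzU : z ∈ U) : (U ∩ interior t).Nonempty := by
  rw [← ht.closure_interior] at hzt
  exact mem_closure_iff.1 hzt U hU hzU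

theorem isCompact_sUnion_prototiles (hfin : Tset.Finite) (htile : ∀ t ∈ Tset, IsTile t) :
    IsCompact (⋃₀ Tset) :=
  hfin.isCompact_sUnion fun t ht => (htile t ht).isCompact

/-- Only finitely many tiles of a tiling of the full shift meet a given compact set: two tiles
with the same prototile whose positions are closer than the inradius of that prototile coincide. -/
theorem finite_tiles_meeting (hfin : Tset.Finite) (htile : ∀ t ∈ Tset, IsTile t)
    {T : Set (Set (E d))} (hT : T ∈ fullShift Tset) {K : Set (E d)} (hK : IsCompact K) :
    {t ∈ T | (t ∩ K).Nonempty}.Finite := by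
  have key : ∀ p ∈ Tset, {t ∈ T | (t ∩ K).Nonempty ∧ ∃ x : E d, t = x +ᵥ p}.Finite := by
    intro p hp
    have hpt := htile p hp
    have hint : (interior p).Nonempty := by
      rw [← closure_nonempty_iff, hpt.closure_interior]
      exact hpt.nonempty
    obtain ⟨c, hc⟩ := hint
    obtain ⟨ρ, hρ, hball⟩ := Metric.isOpen_iff.1 isOpen_interior c hc
    obtain ⟨C, -, hC, hcover⟩ := (hK.sub_set hpt.isCompact).finite_cover_balls (half_pos hρ)
    refine Set.Finite.subset (hC.biUnion (t := fun a => {t ∈ T | ∃ x ∈ ball a (ρ / 2), t = x +ᵥ p})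
      fun a _ => Set.Subsingleton.finite ?_) ?_
    · rintro s ⟨hs, x, hx, rfl⟩ t ⟨ht, y, hy, rfl⟩
      by_contra hne
      refine (hT.1.nonoverlap _ hs _ ht hne).notMem_of_mem_left (a := x + c) ?_ ?_
      · rw [interior_vadd]
        exact Set.vadd_mem_vadd_set hc
      · rw [interior_vadd, Set.mem_vadd_set_iff_neg_vadd_mem]
        refine hball ?_
        have hxy : dist x y < ρ := by
          have := dist_triangle_right x y a
          rw [mem_ball] at hx hy
          linarith
        rw [mem_ball, dist_eq_norm, vadd_eq_add]
        rw [dist_eq_norm] at hxy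
        convert hxy using 2
        abel
    · rintro t ⟨ht, ⟨z, hzt, hzK⟩, x, rfl⟩
      obtain ⟨b, hb, rfl⟩ := hzt
      have hx : x ∈ K - p := Set.mem_sub.2 ⟨_, hzK, b, hb, by simp⟩
      obtain ⟨a, ha, hxa⟩ := Set.mem_iUnion₂.1 (hcover hx)
      exact Set.mem_iUnion₂.2 ⟨a, ha, ht, x, hxa, rfl⟩
  refine (hfin.biUnion key).subset ?_
  rintro t ⟨ht, htK⟩
  obtain ⟨p, hp, x, hx⟩ := hT.2 t ht
  exact Set.mem_iUnion₂.2 ⟨p, hp, ht, htK, x, hx⟩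

/-- The tiles of a tiling of the full shift that meet a compact set form a covering patch. -/
theorem tiles_meeting_mem_coveringPatches (hfin : Tset.Finite) (htile : ∀ t ∈ Tset, IsTile t)
    {T : Set (Set (E d))} (hT : T ∈ fullShift Tset) {K : Set (E d)} (hK : IsCompact K) :
    {t ∈ T | (t ∩ K).Nonempty} ∈ coveringPatches T K := by
  refine ⟨⟨finite_tiles_meeting hfin htile hT hK, fun t ht => ht.1⟩, fun z hz => ?_⟩
  obtain ⟨t, ht, hzt⟩ : z ∈ ⋃₀ T := hT.1.covers ▸ Set.mem_univ z
  exact ⟨t, ⟨ht, z, hzt, hz⟩, hzt⟩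

/-- `T[B_R]` consists of the tiles of `T` whose interior meets the open ball of radius `R`. -/
theorem smallestPatch_ball (hfin : Tset.Finite) (htile : ∀ t ∈ Tset, IsTile t)
    {T : Set (Set (E d))} (hT : T ∈ fullShift Tset) {R : ℝ} (hR : 0 < R) :
    smallestPatch T (ball₀ d R) = {t ∈ T | (ball 0 R ∩ interior t).Nonempty} := by
  have hsub : {t ∈ T | (ball 0 R ∩ interior t).Nonempty} ⊆
      {t ∈ T | (t ∩ ball₀ d R).Nonempty} := by
    rintro t ⟨ht, z, hz, hzt⟩
    exact ⟨ht, z, interior_subset hzt, ball_subset_closedBall hz⟩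
  have hQfin := (finite_tiles_meeting hfin htile hT (isCompact_closedBall 0 R)).subset hsub
  refine Set.Subset.antisymm (Set.sInter_subset_of_mem ⟨⟨hQfin, fun t ht => ht.1⟩, ?_⟩) ?_
  · -- The union of these finitely many tiles is closed, and it contains the open ball.
    have hclosed : IsClosed (⋃₀ {t ∈ T | (ball 0 R ∩ interior t).Nonempty}) :=
      (hQfin.isCompact_sUnion fun t ht => (hT.1.isTile t ht.1).isCompact).isClosed
    rw [ball₀, ← closure_ball 0 hR.ne']
    refine closure_minimal (fun z hz => ?_) hclosed
    obtain ⟨t, ht, hzt⟩ : z ∈ ⋃₀ T := hT.1.covers ▸ Set.mem_univ z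
    exact ⟨t, ⟨ht, (hT.1.isTile t ht).inter_interior_nonempty isOpen_ball hzt hz⟩, hzt⟩
  · rintro t ⟨ht, w, hwB, hwt⟩ P ⟨⟨-, hPT⟩, hcov⟩
    obtain ⟨s, hs, hws⟩ := hcov (ball_subset_closedBall hwB)
    obtain ⟨u, hut, hus⟩ :=
      (hT.1.isTile s (hPT hs)).inter_interior_nonempty isOpen_interior hws hwt
    by_contra htP
    have hne : t ≠ s := fun h => htP (h ▸ hs)
    exact Set.disjoint_left.1 (hT.1.nonoverlap t ht s (hPT hs) hne) hut hus

/-- `T[B_R]` can be read off from any covering patch of `B_R`. -/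
theorem smallestPatch_eq_of_mem_coveringPatches (hfin : Tset.Finite)
    (htile : ∀ t ∈ Tset, IsTile t) {T : Set (Set (E d))} (hT : T ∈ fullShift Tset) {R : ℝ}
    (hR : 0 < R) {P : Set (Set (E d))} (hP : P ∈ coveringPatches T (ball₀ d R)) :
    smallestPatch T (ball₀ d R) = {t ∈ P | (ball 0 R ∩ interior t).Nonempty} := by
  have h := smallestPatch_ball hfin htile hT hR
  refine Set.Subset.antisymm (fun t ht => ⟨ht P hP, ?_⟩) fun t ht => ?_
  · rw [h] at ht
    exact ht.2
  · rw [h]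
    exact ⟨hP.1.2 ht.1, ht.2⟩

/-! ### Comparison of the distances -/

theorem sInf_one_union_le {p : ℝ → Prop} {r : ℝ} (hr : 0 < r) (h : p r) :
    sInf ({1} ∪ {r : ℝ | 0 < r ∧ p r}) ≤ r := by
  refine csInf_le ⟨0, ?_⟩ (Or.inr ⟨hr, h⟩)
  rintro x (rfl | hx)
  · exact zero_le_one
  · exact hx.1.le

/-- The condition defining `ds1` at scale `r` implies the one defining `ds2`: two
tilings that share a covering patch of a ball have the same smallest patch there. -/
theorem ds2_le_of_coveringPatches (hfin : Tset.Finite) (htile : ∀ t ∈ Tset, IsTile t)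
    {T₀ T₁ : Set (Set (E d))} (h₀ : T₀ ∈ fullShift Tset) (h₁ : T₁ ∈ fullShift Tset) {r : ℝ}
    (hr : 0 < r) {x : E d} (hx : x ∈ ball₀ d r) {P₀ P₁ : Set (Set (E d))}
    (hP₀ : P₀ ∈ coveringPatches T₀ (ball₀ d (1 / r))) (hP₁ : P₁ ⊆ T₁) (h : P₀ = x +ᵥ P₁) :
    ds2 T₀ T₁ ≤ r := by
  have hR : 0 < 1 / r := one_div_pos.2 hr
  refine sInf_one_union_le hr ⟨0, mem_closedBall_self hr.le, x, hx, ?_⟩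
  have hP : P₀ ∈ coveringPatches (x +ᵥ T₁) (ball₀ d (1 / r)) :=
    ⟨⟨hP₀.1.1, h ▸ Set.vadd_set_mono hP₁⟩, hP₀.2⟩
  rw [zero_vadd, smallestPatch_eq_of_mem_coveringPatches hfin htile h₀ hR hP₀,
    smallestPatch_eq_of_mem_coveringPatches hfin htile (vadd_mem_fullShift h₁ x) hR hP]

theorem patchDist_le {P₀ P₁ : Set (Set (E d))} {r : ℝ} (hr : 0 ≤ r)
    (h₀ : ∀ t ∈ P₀, ∃ v : E d, ‖v‖ ≤ r ∧ v +ᵥ t ∈ P₁)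
    (h₁ : ∀ t ∈ P₁, ∃ v : E d, ‖v‖ ≤ r ∧ v +ᵥ t ∈ P₀) : patchDist P₀ P₁ ≤ r := by
  refine max_le (Real.sSup_le ?_ hr) (Real.sSup_le ?_ hr)
  · rintro _ ⟨t, ht, rfl⟩
    obtain ⟨v, hv, hvt⟩ := h₀ t ht
    refine (csInf_le ⟨0, ?_⟩ (Set.mem_image_of_mem _ hvt)).trans
      ((hausdorffDist_vadd_le v t).trans hv)
    rintro _ ⟨s, -, rfl⟩
    exact hausdorffDist_nonneg
  · rintro _ ⟨t, ht, rfl⟩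
    obtain ⟨v, hv, hvt⟩ := h₁ t ht
    refine (csInf_le ⟨0, ?_⟩ (Set.mem_image_of_mem _ hvt)).trans ?_
    · rintro _ ⟨s, -, rfl⟩
      exact hausdorffDist_nonneg
    · change hausdorffDist (v +ᵥ t) t ≤ r
      rw [hausdorffDist_comm]
      exact (hausdorffDist_vadd_le v t).trans hv

theorem exists_norm_eq_dist_eq (hd : 0 < d) {z : E d} {R : ℝ} (hz : ‖z‖ ≤ R) :
    ∃ w : E d, ‖w‖ = R ∧ dist z w = R - ‖z‖ := by
  have : Nonempty (Fin d) := ⟨⟨0, hd⟩⟩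
  obtain ⟨u, hu, hzu⟩ : ∃ u : E d, ‖u‖ = 1 ∧ z = ‖z‖ • u := by
    rcases eq_or_ne z 0 with rfl | hz0
    · obtain ⟨u, hu⟩ := exists_norm_eq (E d) zero_le_one
      exact ⟨u, hu, by simp⟩
    · refine ⟨‖z‖⁻¹ • z, norm_smul_inv_norm (𝕜 := ℝ) hz0, ?_⟩
      rw [smul_smul, mul_inv_cancel₀ (norm_ne_zero_iff.2 hz0), one_smul]
  refine ⟨R • u, ?_, ?_⟩
  · rw [norm_smul, hu, mul_one, Real.norm_of_nonneg ((norm_nonneg z).trans hz)]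
  · rw [dist_comm, dist_eq_norm]
    conv_lhs => rw [hzu]
    rw [← sub_smul, norm_smul, hu, mul_one, Real.norm_of_nonneg (sub_nonneg.2 hz)]

/-- If the tiles of `T` meeting `B_R` are tiles of `T'` up to translations of length at most `δ`,
then `∂_R T` lies in the `δ`-neighbourhood of `∂_R T'`. A boundary point that the translation
moves out of `B_R` is close to the sphere `S_R`. -/
theorem exists_mem_rBoundary_dist_le (hd : 0 < d) {T T' : Set (Set (E d))}
    (hT : ∀ t ∈ T, IsClosed t) {R δ : ℝ} (hδ : 0 ≤ δ)
    (h : ∀ t ∈ T, (t ∩ ball₀ d R).Nonempty → ∃ v : E d, ‖v‖ ≤ δ ∧ v +ᵥ t ∈ T') :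
    ∀ z ∈ rBoundary R T, ∃ w ∈ rBoundary R T', dist z w ≤ δ := by
  rintro z (hz | hz)
  · exact ⟨z, Or.inl hz, by rwa [dist_self]⟩
  · obtain ⟨t, ht, hzt, hzR⟩ := Set.mem_iUnion₂.1 hz
    obtain ⟨v, hv, hvt⟩ := h t ht ⟨z, (hT t ht).frontier_subset hzt, hzR⟩
    by_cases hR : ‖v + z‖ ≤ R
    · refine ⟨v + z, Or.inr (Set.mem_iUnion₂.2 ⟨v +ᵥ t, hvt, ?_, ?_⟩), ?_⟩
      · rw [frontier_vadd_set]
        exact Set.vadd_mem_vadd_set hzt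
      · exact mem_closedBall_zero_iff.2 hR
      · simpa using hv
    · obtain ⟨w, hw, hzw⟩ := exists_norm_eq_dist_eq hd (mem_closedBall_zero_iff.1 hzR)
      refine ⟨w, Or.inl (mem_sphere_zero_iff_norm.2 hw), ?_⟩
      have := norm_add_le v z
      rw [hzw]
      linarith

end FullShift

/-! ### The limit of an ultrafilter of tilings -/

section Limit

variable {d : ℕ} {Tset : Set (Set (E d))}

/-- The limit of an ultrafilter `F` on the full shift: the translates `t` of prototiles such that,
for every `ε > 0`, `F`-almost every tiling has a tile that is a translate of `t` by a vector of
length less than `ε`. -/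
def limitTiling (F : Ultrafilter (fullShift Tset)) : Set (Set (E d)) :=
  {t | (∃ p ∈ Tset, ∃ x : E d, t = x +ᵥ p) ∧
    ∀ ε > 0, ∀ᶠ T' : fullShift Tset in F, ∃ v : E d, ‖v‖ < ε ∧
      v +ᵥ t ∈ (T' : Set (Set (E d)))}

theorem _root_.Ultrafilter.exists_tendsto_of_eventually_mem {α X : Type*} [TopologicalSpace X]
    (F : Ultrafilter α) {K : Set X} (hK : IsCompact K) {f : α → X} (h : ∀ᶠ a in F, f a ∈ K) :
    ∃ x ∈ K, Tendsto f F (𝓝 x) :=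
  hK.ultrafilter_le_nhds' (F.map f) h

/-- Extraction of a limit tile: a choice of tiles, all meeting a compact set `K`, in the tilings of
an ultrafilter converges to a tile of the limit that meets `K`. -/
theorem exists_mem_limitTiling (F : Ultrafilter (fullShift Tset)) (hfin : Tset.Finite)
    (htile : ∀ t ∈ Tset, IsTile t) {K : Set (E d)} (hK : IsCompact K)
    {t : fullShift Tset → Set (E d)}
    (ht : ∀ᶠ T' : fullShift Tset in F,
      t T' ∈ (T' : Set (Set (E d))) ∧ (t T' ∩ K).Nonempty) :
    ∃ t₀ ∈ limitTiling F, (t₀ ∩ K).Nonempty ∧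
      ∀ ε > 0, ∀ᶠ T' : fullShift Tset in F, ∃ v : E d, ‖v‖ < ε ∧ v +ᵥ t T' = t₀ := by
  obtain ⟨p, hp, hF⟩ : ∃ p ∈ Tset, ∀ᶠ T' : fullShift Tset in F,
      ∃ x z : E d, t T' ∈ (T' : Set (Set (E d))) ∧ t T' = x +ᵥ p ∧ z ∈ K ∧ z - x ∈ p := by
    rw [← Ultrafilter.eventually_exists_mem_iff hfin]
    filter_upwards [ht] with T' hT'
    obtain ⟨hmem, z, hz, hzK⟩ := hT'
    obtain ⟨p, hp, x, hx⟩ := T'.2.2 _ hmem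
    rw [hx] at hz
    obtain ⟨b, hb, rfl⟩ := hz
    exact ⟨p, hp, x, _, hmem, hx, hzK, by simpa using hb⟩
  have hpt := htile p hp
  choose! x z hxz using fun (T' : fullShift Tset)
    (h : ∃ x z : E d, t T' ∈ (T' : Set (Set (E d))) ∧ t T' = x +ᵥ p ∧ z ∈ K ∧ z - x ∈ p) => h
  replace hF := hF.mono hxz
  obtain ⟨z₀, hz₀, hz⟩ := F.exists_tendsto_of_eventually_mem hK (hF.mono fun T' h => h.2.2.1)
  obtain ⟨b₀, hb₀, hb⟩ := F.exists_tendsto_of_eventually_mem hpt.isCompact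
    (hF.mono fun T' h => h.2.2.2)
  have hx : Tendsto x F (𝓝 (z₀ - b₀)) := by simpa using hz.sub hb
  have hnear : ∀ ε > 0, ∀ᶠ T' : fullShift Tset in F, ‖x T' - (z₀ - b₀)‖ < ε :=
    fun ε hε => (Metric.tendsto_nhds.1 hx ε hε).mono fun T' h => by rwa [dist_eq_norm] at h
  refine ⟨(z₀ - b₀) +ᵥ p, ⟨⟨p, hp, _, rfl⟩, fun ε hε => ?_⟩, ⟨z₀, ?_, hz₀⟩, fun ε hε => ?_⟩
  · filter_upwards [hnear ε hε, hF] with T' h1 h2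
    refine ⟨_, h1, ?_⟩
    rw [vadd_vadd, sub_add_cancel, ← h2.2.1]
    exact h2.1
  · rw [Set.mem_vadd_set_iff_neg_vadd_mem]
    simpa using hb₀
  · filter_upwards [hnear ε hε, hF] with T' h1 h2
    refine ⟨z₀ - b₀ - x T', by rwa [norm_sub_rev], ?_⟩
    rw [h2.2.1, vadd_vadd, sub_add_cancel]

theorem limitTiling_mem_fullShift (F : Ultrafilter (fullShift Tset)) (hfin : Tset.Finite)
    (htile : ∀ t ∈ Tset, IsTile t) : limitTiling F ∈ fullShift Tset := by
  have hT : ∀ t ∈ limitTiling F, IsTile t := by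
    rintro t ⟨⟨p, hp, x, rfl⟩, -⟩
    exact (htile p hp).vadd x
  -- Overlapping limit tiles are limits of overlapping, hence equal, tiles.
  have hsub : ∀ s ∈ limitTiling F, ∀ t ∈ limitTiling F,
      (interior s ∩ interior t).Nonempty → s ⊆ t := by
    rintro s hs t ht ⟨z, hzs, hzt⟩ a ha
    obtain ⟨ρ, hρ, hball⟩ :=
      Metric.isOpen_iff.1 (isOpen_interior.inter isOpen_interior) z ⟨hzs, hzt⟩
    rw [← (hT t ht).isCompact.isClosed.closure_eq, Metric.mem_closure_iff]
    intro ε hε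
    have hη : 0 < min ρ (ε / 2) := lt_min hρ (half_pos hε)
    obtain ⟨T', ⟨v, hv, hvs⟩, w, hw, hwt⟩ := ((hs.2 _ hη).and (ht.2 _ hη)).exists
    have hmem : ∀ u : E d, ‖u‖ < min ρ (ε / 2) → -u +ᵥ z ∈ interior s ∩ interior t := by
      intro u hu
      refine hball ?_
      rw [mem_ball, dist_eq_norm, vadd_eq_add]
      simpa using hu.trans_le (min_le_left _ _)
    have heq : v +ᵥ s = w +ᵥ t := by
      by_contra hne
      refine (T'.2.1.nonoverlap _ hvs _ hwt hne).notMem_of_mem_left (a := z) ?_ ?_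
      · rw [interior_vadd, Set.mem_vadd_set_iff_neg_vadd_mem]
        exact (hmem v hv).1
      · rw [interior_vadd, Set.mem_vadd_set_iff_neg_vadd_mem]
        exact (hmem w hw).2
    have hva : v + a ∈ w +ᵥ t := heq ▸ Set.vadd_mem_vadd_set ha
    rw [Set.mem_vadd_set_iff_neg_vadd_mem] at hva
    refine ⟨_, hva, ?_⟩
    rw [dist_eq_norm, vadd_eq_add, show a - (-w + (v + a)) = w - v by abel]
    have := norm_sub_le w v
    have := min_le_right ρ (ε / 2)
    linarith
  refine ⟨⟨hT, fun s hs t ht hne => ?_, Set.eq_univ_of_forall fun z => ?_⟩, fun t ht => ht.1⟩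
  · by_contra hnd
    rw [Set.not_disjoint_iff_nonempty_inter] at hnd
    exact hne ((hsub s hs t ht hnd).antisymm (hsub t ht s hs (Set.inter_comm _ _ ▸ hnd)))
  · have hcov : ∀ T' : fullShift Tset, ∃ t ∈ (T' : Set (Set (E d))), z ∈ t := fun T' => by
      have : z ∈ ⋃₀ (T' : Set (Set (E d))) := T'.2.1.covers ▸ Set.mem_univ z
      exact this
    choose t ht hzt using hcov
    obtain ⟨t₀, ht₀, ⟨y, hyt, rfl⟩, -⟩ := exists_mem_limitTiling F hfin htile
      (isCompact_singleton (x := z)) (t := t)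
      (Eventually.of_forall fun T' => ⟨ht T', z, hzt T', rfl⟩)
    exact ⟨t₀, ht₀, hyt⟩

/-- Uniform approximation on a compact set `K`: for almost every tiling `T'` of the ultrafilter, the
tiles of `T'` meeting `K` and the tiles of the limit meeting `K` correspond up to small
translations. -/
theorem eventually_near_limitTiling (F : Ultrafilter (fullShift Tset)) (hfin : Tset.Finite)
    (htile : ∀ t ∈ Tset, IsTile t) {K : Set (E d)} (hK : IsCompact K) {δ : ℝ} (hδ : 0 < δ) :
    ∀ᶠ T' : fullShift Tset in F,
      (∀ t ∈ (T' : Set (Set (E d))), (t ∩ K).Nonempty →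
        ∃ v : E d, ‖v‖ < δ ∧ v +ᵥ t ∈ limitTiling F ∧ ((v +ᵥ t) ∩ K).Nonempty) ∧
      ∀ t ∈ limitTiling F, (t ∩ K).Nonempty →
        ∃ v : E d, ‖v‖ < δ ∧ v +ᵥ t ∈ (T' : Set (Set (E d))) := by
  refine Eventually.and ?_ ?_
  · by_contra hnot
    rw [← Ultrafilter.eventually_not] at hnot
    push Not at hnot
    choose! t ht hmeet hfar using fun (T' : fullShift Tset)
      (h : ∃ t ∈ (T' : Set (Set (E d))), (t ∩ K).Nonempty ∧
        ∀ v : E d, ‖v‖ < δ → v +ᵥ t ∈ limitTiling F → (v +ᵥ t) ∩ K = ∅) => h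
    obtain ⟨t₀, ht₀, hmeet₀, hlim⟩ := exists_mem_limitTiling F hfin htile hK (t := t)
      (hnot.mono fun T' h => ⟨ht T' h, hmeet T' h⟩)
    obtain ⟨T', hT', v, hv, hvt⟩ := (hnot.and (hlim δ hδ)).exists
    refine hmeet₀.ne_empty ?_
    rw [← hvt]
    exact hfar T' hT' v hv (hvt ▸ ht₀)
  · have hfinK := finite_tiles_meeting hfin htile (limitTiling_mem_fullShift F hfin htile) hK
    have := (hfinK.eventually_all (l := (F : Filter (fullShift Tset)))
      (p := fun t (T' : fullShift Tset) =>
        ∃ v : E d, ‖v‖ < δ ∧ v +ᵥ t ∈ (T' : Set (Set (E d))))).2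
      fun t ht => ht.1.2 δ hδ
    exact this.mono fun T' h t ht htK => h t ⟨ht, htK⟩

/-! ### Convergence to the limit -/

/-- The ultrafilter `F` converges to its limit tiling for the distance `δ`, in the sense that it
contains the balls for `δ` around the limit. No triangle inequality for `δ` is involved. -/
def ConvergesFor (δ : Set (Set (E d)) → Set (Set (E d)) → ℝ) (F : Ultrafilter (fullShift Tset)) :
    Prop :=
  ∀ ε > 0, ∀ᶠ T' : fullShift Tset in F, δ (limitTiling F) T' < ε

theorem ConvergesFor.of_le {δ : Set (Set (E d)) → Set (Set (E d)) → ℝ}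
    {F : Ultrafilter (fullShift Tset)}
    (h : ∀ r > 0, ∀ᶠ T' : fullShift Tset in F, δ (limitTiling F) T' ≤ r) :
    ConvergesFor δ F := fun ε hε =>
  (h (ε / 2) (half_pos hε)).mono fun _ h' => h'.trans_lt (half_lt_self hε)

theorem convergesFor_dw1 (F : Ultrafilter (fullShift Tset)) (hfin : Tset.Finite)
    (htile : ∀ t ∈ Tset, IsTile t) : ConvergesFor dw1 F := by
  refine .of_le fun r hr => ?_
  have hK : IsCompact (ball₀ d (1 / r)) := isCompact_closedBall _ _
  have hlim := limitTiling_mem_fullShift F hfin htile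
  set P₀ := {t ∈ limitTiling F | (t ∩ ball₀ d (1 / r)).Nonempty}
  have hP₀fin : P₀.Finite := finite_tiles_meeting hfin htile hlim hK
  filter_upwards [eventually_near_limitTiling F hfin htile hK hr] with T' hT'
  -- These tiles include all tiles of `T'` that meet the ball. The latter alone would not do: a tile
  -- of `P₀` that only touches the ball may correspond to a tile of `T'` that misses it.
  set P₁ := {t ∈ (T' : Set (Set (E d))) | ∃ v : E d, ‖v‖ < r ∧ v +ᵥ t ∈ P₀}
  have hP₁fin : P₁.Finite := by
    have hbig : IsCompact (⋃₀ P₀ + closedBall 0 r) :=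
      (hP₀fin.isCompact_sUnion fun t ht => (hlim.1.isTile t ht.1).isCompact).add
        (isCompact_closedBall 0 r)
    refine (finite_tiles_meeting hfin htile T'.2 hbig).subset ?_
    rintro t ⟨ht, v, hv, hvt⟩
    obtain ⟨a, ha⟩ := (T'.2.1.isTile t ht).nonempty
    refine ⟨ht, a, ha, Set.mem_add.2 ⟨v + a, ⟨_, hvt, Set.vadd_mem_vadd_set ha⟩, -v, ?_, by simp⟩⟩
    simpa using hv.le
  refine sInf_one_union_le hr ⟨P₀, tiles_meeting_mem_coveringPatches hfin htile hlim hK, P₁,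
    ⟨⟨hP₁fin, fun t ht => ht.1⟩, fun z hz => ?_⟩, patchDist_le hr.le ?_ ?_⟩
  · obtain ⟨t, ht, hzt⟩ : z ∈ ⋃₀ (T' : Set (Set (E d))) := T'.2.1.covers ▸ Set.mem_univ z
    exact ⟨t, ⟨ht, hT'.1 t ht ⟨z, hzt, hz⟩⟩, hzt⟩
  · intro t ht
    obtain ⟨v, hv, hvt⟩ := hT'.2 t ht.1 ht.2
    refine ⟨v, hv.le, hvt, -v, by rwa [norm_neg], ?_⟩
    rwa [neg_vadd_vadd]
  · rintro t ⟨-, v, hv, hvt⟩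
    exact ⟨v, hv.le, hvt⟩

theorem convergesFor_dw2 (hd : 0 < d) (F : Ultrafilter (fullShift Tset)) (hfin : Tset.Finite)
    (htile : ∀ t ∈ Tset, IsTile t) : ConvergesFor dw2 F := by
  refine .of_le fun r hr => ?_
  have hlim := limitTiling_mem_fullShift F hfin htile
  filter_upwards [eventually_near_limitTiling F hfin htile
    (isCompact_closedBall (0 : E d) (1 / r)) hr] with T' hT'
  refine sInf_one_union_le hr (hausdorffDist_le_of_mem_dist hr.le ?_ ?_)
  · refine exists_mem_rBoundary_dist_le hd (fun t ht => (hlim.1.isTile t ht).isCompact.isClosed)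
      hr.le fun t ht htR => ?_
    obtain ⟨v, hv, hvt⟩ := hT'.2 t ht htR
    exact ⟨v, hv.le, hvt⟩
  · refine exists_mem_rBoundary_dist_le hd (fun t ht => (T'.2.1.isTile t ht).isCompact.isClosed)
      hr.le fun t ht htR => ?_
    obtain ⟨v, hv, hvt, -⟩ := hT'.1 t ht htR
    exact ⟨v, hv.le, hvt⟩

/-- Under finite local complexity, almost every tiling of the ultrafilter agrees with the limit on
a given ball up to a small translation: by pigeonhole, the patches covering a larger ball are
almost all translates `x + Q` of one patch `Q`, and the vectors `x` converge. -/
theorem eventually_exists_common_patch (F : Ultrafilter (fullShift Tset)) (hfin : Tset.Finite)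
    (htile : ∀ t ∈ Tset, IsTile t) {X : Set (fullShift Tset)} (hX : IsFLC X) (hXF : X ∈ F)
    {r : ℝ} (hr : 0 < r) :
    ∀ᶠ T' : fullShift Tset in F, ∃ x ∈ ball₀ d r,
      ∃ P₀ ∈ coveringPatches (limitTiling F) (ball₀ d (1 / r)),
      ∃ P₁ ∈ coveringPatches (T' : Set (Set (E d))) (ball₀ d (1 / r)), P₀ = x +ᵥ P₁ := by
  have hR : 0 < 1 / r := one_div_pos.2 hr
  have hK : IsCompact (ball₀ d (1 / r + 1)) := isCompact_closedBall _ _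
  have hU := isCompact_sUnion_prototiles hfin htile
  -- The set `L` is compact and contains every translate of a prototile that meets the ball.
  have hL := (hK.sub_set hU).add hU
  set L := ball₀ d (1 / r + 1) - ⋃₀ Tset + ⋃₀ Tset
  obtain ⟨𝒬, h𝒬, hFLC⟩ := hX L hL
  obtain ⟨Q, -, hQ⟩ : ∃ Q ∈ 𝒬, ∀ᶠ T' : fullShift Tset in F, ∃ x : E d,
      {t ∈ (T' : Set (Set (E d))) | (t ∩ ball₀ d (1 / r + 1)).Nonempty} = x +ᵥ Q := by
    rw [← Ultrafilter.eventually_exists_mem_iff h𝒬]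
    filter_upwards [hXF] with T' hT'
    refine hFLC _ ⟨T', hT', (tiles_meeting_mem_coveringPatches hfin htile T'.2 hK).1, ?_⟩
    rintro y ⟨t, ⟨ht, z, hzt, hz⟩, hyt⟩
    obtain ⟨p, hp, x, rfl⟩ := T'.2.2 t ht
    obtain ⟨a, ha, rfl⟩ := hzt
    obtain ⟨b, hb, rfl⟩ := hyt
    exact Set.add_mem_add (Set.mem_sub.2 ⟨_, hz, a, ⟨p, hp, ha⟩, by simp⟩) ⟨p, hp, hb⟩
  choose! x hx using fun (T' : fullShift Tset) (h : ∃ x : E d,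
    {t ∈ (T' : Set (Set (E d))) | (t ∩ ball₀ d (1 / r + 1)).Nonempty} = x +ᵥ Q) => h
  replace hQ := hQ.mono hx
  have hpatch : ∀ᶠ T' : fullShift Tset in F,
      x T' +ᵥ Q ∈ coveringPatches (T' : Set (Set (E d))) (ball₀ d (1 / r + 1)) :=
    hQ.mono fun T' h => h ▸ tiles_meeting_mem_coveringPatches hfin htile T'.2 hK
  obtain ⟨x₀, hx₀⟩ : ∃ x₀, Tendsto x F (𝓝 x₀) := by
    -- The vectors `x` are bounded, since a fixed tile of `Q` is moved by them onto the ball.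
    obtain ⟨q, hq, hqc⟩ : ∃ q ∈ Q, IsCompact q := by
      obtain ⟨T', hT'⟩ := hpatch.exists
      obtain ⟨_, ⟨q, hq, rfl⟩, -⟩ := hT'.2 (mem_closedBall_self (by positivity))
      refine ⟨q, hq, ?_⟩
      have h := (T'.2.1.isTile _ (hT'.1.2 (Set.vadd_mem_vadd_set hq))).isCompact.vadd (-x T')
      rwa [neg_vadd_vadd] at h
    obtain ⟨x₀, -, h⟩ := F.exists_tendsto_of_eventually_mem (hK.sub_set hqc) (f := x)
      (hQ.mono fun T' h => by
        have hmem : x T' +ᵥ q ∈ x T' +ᵥ Q := Set.vadd_mem_vadd_set hq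
        rw [← h] at hmem
        obtain ⟨-, z, ⟨b, hb, rfl⟩, hz⟩ := hmem
        exact Set.mem_sub.2 ⟨_, hz, b, hb, by simp⟩)
    exact ⟨x₀, h⟩
  have hnear : ∀ ε > 0, ∀ᶠ T' : fullShift Tset in F, ‖x T' - x₀‖ < ε :=
    fun ε hε => (Metric.tendsto_nhds.1 hx₀ ε hε).mono fun T' h => by rwa [dist_eq_norm] at h
  have hsub : x₀ +ᵥ Q ⊆ limitTiling F := by
    rintro _ ⟨q, hq, rfl⟩
    refine ⟨?_, fun ε hε => ?_⟩
    · obtain ⟨T', hT'⟩ := hpatch.exists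
      obtain ⟨p, hp, y, hy⟩ := T'.2.2 _ (hT'.1.2 (Set.vadd_mem_vadd_set hq))
      refine ⟨p, hp, x₀ + (-x T' + y), ?_⟩
      rw [add_vadd, add_vadd, ← hy, neg_vadd_vadd]
    · filter_upwards [hpatch, hnear ε hε] with T' h1 h2
      refine ⟨_, h2, ?_⟩
      rw [vadd_vadd, sub_add_cancel]
      exact h1.1.2 (Set.vadd_mem_vadd_set hq)
  filter_upwards [hpatch, hnear (min 1 r) (lt_min one_pos hr)] with T' h1 h2
  have h2' : ‖x₀ - x T'‖ < min 1 r := by rwa [norm_sub_rev]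
  have heq : x₀ +ᵥ Q = (x₀ - x T') +ᵥ (x T' +ᵥ Q) := by rw [vadd_vadd, sub_add_cancel]
  refine ⟨x₀ - x T', mem_closedBall_zero_iff.2 (h2'.le.trans (min_le_right _ _)),
    x₀ +ᵥ Q, ⟨⟨?_, hsub⟩, fun z hz => ?_⟩, x T' +ᵥ Q, ⟨h1.1, ?_⟩, heq⟩
  · rw [heq]
    exact h1.1.1.vadd_set
  · -- The radius was enlarged by `1` so that the translated patch still covers the ball.
    have hz' : -(x₀ - x T') + z ∈ ball₀ d (1 / r + 1) := by
      rw [mem_closedBall_zero_iff] at hz ⊢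
      have := norm_add_le (-(x₀ - x T')) z
      rw [norm_neg] at this
      have := min_le_left 1 r
      linarith
    obtain ⟨t, ht, hzt⟩ := h1.2 hz'
    rw [heq]
    exact ⟨_, Set.vadd_mem_vadd_set ht, Set.mem_vadd_set_iff_neg_vadd_mem.2 hzt⟩
  · exact (closedBall_subset_closedBall (by linarith)).trans h1.2

theorem convergesFor_ds1 (F : Ultrafilter (fullShift Tset)) (hfin : Tset.Finite)
    (htile : ∀ t ∈ Tset, IsTile t) {X : Set (fullShift Tset)} (hX : IsFLC X) (hXF : X ∈ F) :
    ConvergesFor ds1 F :=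
  .of_le fun _ hr => (eventually_exists_common_patch F hfin htile hX hXF hr).mono
    fun _ h => sInf_one_union_le hr h

theorem convergesFor_ds2 (F : Ultrafilter (fullShift Tset)) (hfin : Tset.Finite)
    (htile : ∀ t ∈ Tset, IsTile t) {X : Set (fullShift Tset)} (hX : IsFLC X) (hXF : X ∈ F) :
    ConvergesFor ds2 F := by
  refine .of_le fun r hr => (eventually_exists_common_patch F hfin htile hX hXF hr).mono ?_
  rintro T' ⟨x, hx, P₀, hP₀, P₁, hP₁, h⟩
  exact ds2_le_of_coveringPatches hfin htile (limitTiling_mem_fullShift F hfin htile) T'.2 hr hx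
    hP₀ hP₁.1.2 h

/-! ### Compactness -/

theorem ConvergesFor.le_nhds {δ : Set (Set (E d)) → Set (Set (E d)) → ℝ}
    {F : Ultrafilter (fullShift Tset)} (h : ConvergesFor δ F)
    (hlim : limitTiling F ∈ fullShift Tset) :
    (F : Filter (fullShift Tset)) ≤ @nhds _ (distTopology Tset δ) ⟨limitTiling F, hlim⟩ := by
  let := distTopology Tset δ
  rw [le_nhds_iff]
  intro U hU hopen
  obtain ⟨ε, hε, hball⟩ := hopen _ hU
  exact (h ε hε).mono fun T' hT' => hball T' hT'

/-- The distance `δ` for which `X` is closed and the distance `δ'` for which `X` is compact may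
differ: ultrafilters have the same limit for all the distances. -/
theorem isCompactFor_of_convergesFor {δ δ' : Set (Set (E d)) → Set (Set (E d)) → ℝ}
    (hfin : Tset.Finite) (htile : ∀ t ∈ Tset, IsTile t) {X : Set (fullShift Tset)}
    (hX : IsClosedFor δ X)
    (hδ : ∀ F : Ultrafilter (fullShift Tset), X ∈ F → ConvergesFor δ F)
    (hδ' : ∀ F : Ultrafilter (fullShift Tset), X ∈ F → ConvergesFor δ' F) :
    IsCompactFor δ' X := by
  refine (@isCompact_iff_ultrafilter_le_nhds' _ (distTopology Tset δ') X).2 fun F hXF => ?_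
  have hlim := limitTiling_mem_fullShift F hfin htile
  exact ⟨⟨_, hlim⟩,
    (@isClosed_iff_ultrafilter _ X (distTopology Tset δ)).1 hX _ F ((hδ F hXF).le_nhds hlim) hXF,
    (hδ' F hXF).le_nhds hlim⟩

end Limit

end TilingSpace

theorem mainTheorem4 (d : ℕ) (hd : 0 < d) (Tset : Set (Set (E d))) (hfin : Tset.Finite)
    (htile : ∀ t ∈ Tset, IsTile t) :
    (∀ X : Set (fullShift Tset), IsFLC X →
      (IsSubshift ds1 X ∨ IsSubshift ds2 X ∨ IsSubshift dw1 X ∨ IsSubshift dw2 X) →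
        IsCompactFor ds1 X ∧ IsCompactFor ds2 X ∧ IsCompactFor dw1 X ∧ IsCompactFor dw2 X) ∧
    (∀ X : Set (fullShift Tset), (IsSubshift dw1 X ∨ IsSubshift dw2 X) →
        IsCompactFor dw1 X ∧ IsCompactFor dw2 X) ∧
    (IsCompactFor dw1 (Set.univ : Set (fullShift Tset)) ∧
      IsCompactFor dw2 (Set.univ : Set (fullShift Tset))) := by
  have weak : ∀ (δ : Set (Set (E d)) → Set (Set (E d)) → ℝ) (X : Set (fullShift Tset)),
      IsClosedFor δ X → (∀ F : Ultrafilter (fullShift Tset), X ∈ F → ConvergesFor δ F) →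
        IsCompactFor dw1 X ∧ IsCompactFor dw2 X := fun δ X hX hδ =>
    ⟨isCompactFor_of_convergesFor hfin htile hX hδ fun F _ => convergesFor_dw1 F hfin htile,
      isCompactFor_of_convergesFor hfin htile hX hδ fun F _ => convergesFor_dw2 hd F hfin htile⟩
  have all : ∀ (δ : Set (Set (E d)) → Set (Set (E d)) → ℝ) (X : Set (fullShift Tset)), IsFLC X →
      IsClosedFor δ X → (∀ F : Ultrafilter (fullShift Tset), X ∈ F → ConvergesFor δ F) →
        IsCompactFor ds1 X ∧ IsCompactFor ds2 X ∧ IsCompactFor dw1 X ∧ IsCompactFor dw2 X :=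
    fun δ X hFLC hX hδ =>
      ⟨isCompactFor_of_convergesFor hfin htile hX hδ fun F hF =>
          convergesFor_ds1 F hfin htile hFLC hF,
        isCompactFor_of_convergesFor hfin htile hX hδ fun F hF =>
          convergesFor_ds2 F hfin htile hFLC hF,
        weak δ X hX hδ⟩
  refine ⟨fun X hFLC hX => ?_, fun X hX => ?_, ?_⟩
  · rcases hX with hX | hX | hX | hX
    · exact all _ X hFLC hX.closed fun F hF => convergesFor_ds1 F hfin htile hFLC hF
    · exact all _ X hFLC hX.closed fun F hF => convergesFor_ds2 F hfin htile hFLC hF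
    · exact all _ X hFLC hX.closed fun F _ => convergesFor_dw1 F hfin htile
    · exact all _ X hFLC hX.closed fun F _ => convergesFor_dw2 hd F hfin htile
  · rcases hX with hX | hX
    · exact weak _ X hX.closed fun F _ => convergesFor_dw1 F hfin htile
    · exact weak _ X hX.closed fun F _ => convergesFor_dw2 hd F hfin htile
  · exact weak dw1 Set.univ (@isClosed_univ _ (distTopology Tset dw1))
      fun F _ => convergesFor_dw1 F hfin htile
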